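/- Let $1\le k<n$ be integers and $s\in(1/2,1)$. Write points of $\mathbb{R}^n=\mathbb{R}^k\times\mathbb{R}^{n-k}$ as $(y,z)$, let $\mathcal{H}^k$ be Lebesgue measure on $\mathbb{R}^k$, $\omega_k=\mathcal{H}^k(B_1)$, and let $c_{n,s}=\dfrac{4^s\,\Gamma(n/2+s)}{\pi^{n/2}\,|\Gamma(-s)|}$ be the normalization constant of the fractional Laplacian $\Delta^s=-(-\Delta)^s$ on $\mathbb{R}^n$. Let $\mathcal{K}_k^s$ be the set of measurable $K:\mathbb{R}^n\to[0,\infty)$ with measurable slices $K(\cdot,z)$ such that, for all $z\in\mathbb{R}^{n-k}$ and $r>0$, $$\mathcal{H}^k\big(\{y\in\mathbb{R}^k: K(y,z)>r^{-n-2s}\}\big)=\begin{cases}\mathcal{H}^k\big(B_{(r^2-|z|^2)^{1/2}}\big)&\text{if }|z|<r,\\ 0&\text{if }|z|\ge r.\end{cases}$$ Let $x\in\mathbb{R}^n$ and let $u:\mathbb{R}^n\to\mathbb{R}$ be continuous and $C^{1,1}$ at $x$, i.e. there are $p\in\mathbb{R}^n$, $\rho>0$, $C>0$ with $|u(x+h)-u(x)-h\cdot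 p|\le C|h|^2$ for $|h|<\rho$. Put $\tilde u_x(h)=u(x+h)-u(x)-h\cdot\nabla u(x)$, and assume that $$\int_{\mathbb{R}^n}\frac{|u(w)|}{(1+|w|)^{n+2s}}\,dw<\infty,\qquad \tilde u_x(h)\ge 0\ \text{ for all } h\in\mathbb{R}^n,$$ and that $\mathcal{H}^k(\{y\in\mathbb{R}^k:\tilde u_x(y,z)\le t\})<\infty$ for all $t>0$ and $z\in\mathbb{R}^{n-k}$. Define $$\mathcal{F}_k^su(x)=c_{n,s}\inf_{K\in\mathcal{K}_k^s}\int_{\mathbb{R}^n}\tilde u_x(h)K(h)\,dh ,$$ where each integral takes values in $[0,\infty]$. Then $$\mathcal{F}_k^su(x)=c_{n,s}\int_0^\infty\int_{\mathbb{R}^{n-k}}\frac{1}{|z|^{n-k+2s}}\,W\Big(\frac{\mu_xu(t,z)^{1/k}}{|z|}\Big)\,dz\,dt,$$ where $\mu_xu(t,z)=\omega_k^{-1}\mathcal{H}^k\big(\{y\in\mathbb{R}^k:\tilde u_x(y,z)\le t\}\big)$ and $$W(\rho)=k\,\omega_k\int_\rho^\infty\frac{r^{k-1}}{(1+r^2)^{\frac{n+2s}{2}}}\,dr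 ;$$ the integrand on the right-hand side is integrable over $(0,\infty)\times\mathbb{R}^{n-k}$, so that both sides are finite. -/

import Mathlib

open MeasureTheory
open scoped ENNReal Gradient

namespace NonlocalMA

/-- The point `(y, z)` of `ℝⁿ = ℝᵏ × ℝⁿ⁻ᵏ`: `y` fills the first `k` coordinates, `z` the others. -/
noncomputable def join {n k : ℕ} (y : EuclideanSpace ℝ (Fin k))
    (z : EuclideanSpace ℝ (Fin (n - k))) : EuclideanSpace ℝ (Fin n) :=
  WithLp.toLp 2 fun i : Fin n =>
    if h : (i : ℕ) < k then y ⟨i, h⟩ else z ⟨(i : ℕ) - k, by omega⟩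

/-- `ω_k`, the volume of the unit ball of `ℝᵏ`. The `k`-dimensional Hausdorff measure on `ℝᵏ`,
normalised so that the unit ball has measure `π^{k/2} / Γ(k/2 + 1)`, is Lebesgue measure, which is
`volume` on `EuclideanSpace ℝ (Fin k)`. -/
noncomputable def omega (k : ℕ) : ℝ :=
  volume.real (Metric.ball (0 : EuclideanSpace ℝ (Fin k)) 1)

/-- The constant `c_{n,s} = 4^s Γ(n/2 + s) / (π^{n/2} |Γ(-s)|)` of the fractional Laplacian
`Δ^s u(x₀) = c_{n,s} PV ∫ (u(x₀ + x) - u(x₀)) |x|^{-n-2s} dx`, that is, of `-(-Δ)^s`. -/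
noncomputable def fracConst (n : ℕ) (s : ℝ) : ℝ :=
  (4 : ℝ) ^ s * Real.Gamma ((n : ℝ) / 2 + s) / (Real.pi ^ ((n : ℝ) / 2) * |Real.Gamma (-s)|)

/-- `u` is `C^{1,1}` at the point `x₀`. -/
def IsC11At {n : ℕ} (u : EuclideanSpace ℝ (Fin n) → ℝ) (x₀ : EuclideanSpace ℝ (Fin n)) : Prop :=
  ∃ p : EuclideanSpace ℝ (Fin n), ∃ ρ > (0 : ℝ), ∃ C > (0 : ℝ),
    ∀ x : EuclideanSpace ℝ (Fin n), ‖x‖ < ρ →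
      |u (x₀ + x) - u x₀ - inner ℝ x p| ≤ C * ‖x‖ ^ 2

/-- `ũ(x) = u(x₀ + x) - u(x₀) - x · ∇u(x₀)`. -/
noncomputable def tilde {n : ℕ} (u : EuclideanSpace ℝ (Fin n) → ℝ)
    (x₀ x : EuclideanSpace ℝ (Fin n)) : ℝ :=
  u (x₀ + x) - u x₀ - inner ℝ x (∇ u x₀)

/-- The class `𝒦_k^s` of admissible kernels on `ℝⁿ`: nonnegative (Lebesgue) measurable functions,
with measurable slices, such that every slice `K(·, z)` has the same distribution function as the
slice of `|x|^{-n-2s}`. -/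
structure IsKernel {n : ℕ} (k : ℕ) (s : ℝ) (K : EuclideanSpace ℝ (Fin n) → ℝ) : Prop where
  nonneg : ∀ x, 0 ≤ K x
  measurable : AEMeasurable K volume
  measurable_slice : ∀ z : EuclideanSpace ℝ (Fin (n - k)),
    AEMeasurable (fun y : EuclideanSpace ℝ (Fin k) => K (join y z)) volume
  volume_slice : ∀ (z : EuclideanSpace ℝ (Fin (n - k))) (r : ℝ), 0 < r →
    volume {y : EuclideanSpace ℝ (Fin k) | r ^ (-((n : ℝ) + 2 * s)) < K (join y z)} =
      if ‖z‖ < r then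
        volume (Metric.ball (0 : EuclideanSpace ℝ (Fin k)) (Real.sqrt (r ^ 2 - ‖z‖ ^ 2)))
      else 0

/-- The Lebesgue integral `∫ f⁺ - ∫ f⁻` with values in `[-∞, ∞]`; for `f ≥ 0` it is the integral of
`f` with values in `[0, ∞]`. -/
noncomputable def extIntegral {n : ℕ} (f : EuclideanSpace ℝ (Fin n) → ℝ) : EReal :=
  ((∫⁻ x, ENNReal.ofReal (f x) : ℝ≥0∞) : EReal) - ((∫⁻ x, ENNReal.ofReal (-f x) : ℝ≥0∞) : EReal)

/-- The operator `F_k^s u(x₀) = c_{n,s} inf_K ∫ ũ(x) K(x) dx`, the infimum being over `𝒦_k^s`. -/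
noncomputable def fracOp {n : ℕ} (k : ℕ) (s : ℝ) (u : EuclideanSpace ℝ (Fin n) → ℝ)
    (x₀ : EuclideanSpace ℝ (Fin n)) : EReal :=
  (fracConst n s : EReal) *
    ⨅ K : {K : EuclideanSpace ℝ (Fin n) → ℝ // IsKernel k s K},
      extIntegral fun x => tilde u x₀ x * K.1 x

/-- `μ_{x₀} u(t, z) = ω_k⁻¹ H^k({y ∈ ℝᵏ : ũ(y, z) ≤ t})`. -/
noncomputable def mu {n : ℕ} (k : ℕ) (u : EuclideanSpace ℝ (Fin n) → ℝ)
    (x₀ : EuclideanSpace ℝ (Fin n)) (t : ℝ) (z : EuclideanSpace ℝ (Fin (n - k))) : ℝ :=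
  (omega k)⁻¹ * volume.real {y : EuclideanSpace ℝ (Fin k) | tilde u x₀ (join y z) ≤ t}

/-- `W(ρ) = k ω_k ∫_ρ^∞ r^{k-1} (1 + r²)^{-(n+2s)/2} dr`. -/
noncomputable def W (n k : ℕ) (s ρ : ℝ) : ℝ :=
  (k : ℝ) * omega k *
    ∫ r in Set.Ioi ρ, r ^ (k - 1) / (1 + r ^ 2) ^ (((n : ℝ) + 2 * s) / 2)

/-- The integrand `|z|^{-(n-k+2s)} W(μ_{x₀} u(t, z)^{1/k} / |z|)`. -/
noncomputable def integrand {n : ℕ} (k : ℕ) (s : ℝ) (u : EuclideanSpace ℝ (Fin n) → ℝ)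
    (x₀ : EuclideanSpace ℝ (Fin n)) (t : ℝ) (z : EuclideanSpace ℝ (Fin (n - k))) : ℝ :=
  1 / ‖z‖ ^ ((n : ℝ) - k + 2 * s) * W n k s (mu k u x₀ t z ^ (1 / (k : ℝ)) / ‖z‖)

end NonlocalMA

/-! The argument is a bathtub principle on each slice `z ≠ 0`. Applying the layer cake formula to
both factors (`lintegral_ofReal_mul_eq_lintegral_meas`) turns `∫ ũ K dy` into the integral over
levels `t, l > 0` of the measure of `{K > l} \ {ũ ≤ t}`. That measure is at least `|{K > l}| - |{ũ ≤
t}|`, truncated at zero, and admissibility prescribes `|{K > l}|`. The bound is therefore the same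
for all kernels. It equals the integral of `|h|^{-n-2s}` over the part of the slice outside a ball
of volume `|{ũ ≤ t}|`, which scaling and polar coordinates turn into the `W` term
(`lintegral_volume_sub_eq_integrand`).

Equality holds when the sets `{K > l}` and `{ũ ≤ t}` are nested. A kernel achieving this is `(τ² +
|z|²)^{-(n+2s)/2}`, where `τ(z, y)` is the radius of the ball whose volume is that of the set of
points preceding `y` when the slice is ordered by `ũ`. Breaking ties by `|y|` makes ties null, so
the rank pushes Lebesgue measure on the slice to Lebesgue measure on the half-line
(`measure_rank_lt`), and `τ` is distributed like `|y|` (`isKernel_of_radius`).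

Finiteness follows by testing the lower bound with `|h|^{-n-2s}` itself
(`integrable_tilde_mul_norm_rpow`). -/

namespace NonlocalMA

/-! ### Rank of a point in an order with null ties -/

section Rank

variable {α L : Type*} [MeasurableSpace α] [LinearOrder L]

/-- If almost every point has few predecessors, the total mass is small. -/
theorem measure_univ_le_of_measure_lt_le {ν : Measure α} [IsFiniteMeasure ν] {g : α → L}
    (hg : MeasurableSet {p : α × α | g p.1 < g p.2}) (hties : ∀ y, ν {y' | g y' = g y} = 0)
    {ε : ℝ≥0∞} (hε : ∀ᵐ y ∂ν, ν {y' | g y' < g y} ≤ ε) : ν Set.univ ≤ 2 * ε := by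
  by_cases h0 : ν Set.univ = 0
  · simp [h0]
  have hbound : (ν.prod ν) {p : α × α | g p.1 < g p.2} ≤ ε * ν Set.univ := by
    rw [Measure.prod_apply_symm hg]
    calc _ ≤ ∫⁻ _, ε ∂ν := lintegral_mono_ae hε
      _ = _ := by simp
  -- Up to ties, the square splits into the pairs with `g y' < g y` and their mirror images, two
  -- sets of equal mass; one factor is then cancelled.
  have hsq : ν Set.univ * ν Set.univ ≤ 2 * ε * ν Set.univ := by
    have hm1 : Measurable fun y => ν {y' | g y' < g y} := measurable_measure_prodMk_right hg
    have hm2 : Measurable fun y => ν {y' | g y < g y'} := measurable_measure_prodMk_left hg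
    calc ν Set.univ * ν Set.univ = ∫⁻ _, ν Set.univ ∂ν := by simp
      _ ≤ ∫⁻ y, (ν {y' | g y' < g y} + ν {y' | g y < g y'}) ∂ν := by
        refine lintegral_mono fun y => ?_
        calc ν Set.univ ≤ ν (({y' | g y' < g y} ∪ {y' | g y < g y'}) ∪ {y' | g y' = g y}) := by
              refine measure_mono fun y' _ => ?_
              rcases lt_trichotomy (g y') (g y) with h | h | h
              · exact Or.inl (Or.inl h)
              · exact Or.inr h
              · exact Or.inl (Or.inr h)
          _ ≤ _ := measure_union_le _ _
          _ ≤ _ := by rw [hties, add_zero]; exact measure_union_le _ _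
      _ = (ν.prod ν) {p : α × α | g p.1 < g p.2} + (ν.prod ν) {p : α × α | g p.1 < g p.2} := by
        rw [lintegral_add_left hm1]
        nth_rewrite 1 [Measure.prod_apply_symm hg]
        rw [Measure.prod_apply hg]; rfl
      _ ≤ ε * ν Set.univ + ε * ν Set.univ := by gcongr
      _ = _ := by ring
  exact (ENNReal.mul_le_mul_iff_left h0 (measure_ne_top _ _)).1 hsq

/-- The mass of the points preceding `y` in the order induced by `g`. -/
noncomputable def rank (μ : Measure α) (g : α → L) (y : α) : ℝ≥0∞ := μ {y' | g y' < g y}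

theorem rank_mono {μ : Measure α} {g : α → L} {y y' : α} (h : g y ≤ g y') :
    rank μ g y ≤ rank μ g y' :=
  measure_mono fun _ hx => lt_of_lt_of_le hx h

variable {μ : Measure α} [SigmaFinite μ] {g : α → L}

theorem measurable_rank (hg : MeasurableSet {p : α × α | g p.1 < g p.2}) :
    Measurable (rank μ g) :=
  measurable_measure_prodMk_right hg

/-- Take `y0` of rank below `M` nearly attaining the supremum of such ranks. The points of rank
below `M` not preceding `y0` have few predecessors among themselves, hence little mass; the others
have mass `rank y0 ≤ M`. -/
theorem measure_rank_lt_le (hg : MeasurableSet {p : α × α | g p.1 < g p.2})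
    (hties : ∀ y, μ {y' | g y' = g y} = 0) (hfin : ∀ y, rank μ g y ≠ ∞) {M : ℝ≥0∞}
    (hM : M ≠ ∞) : μ {y | rank μ g y < M} ≤ M := by
  have hP : ∀ y, MeasurableSet {y' | g y' < g y} := fun y => hg.preimage measurable_prodMk_right
  have hD : MeasurableSet {y | rank μ g y < M} :=
    measurable_rank hg measurableSet_Iio
  refine ENNReal.le_of_forall_pos_le_add fun ε hε _ => ?_
  rcases Set.eq_empty_or_nonempty {y | rank μ g y < M} with he | ⟨y1, hy1⟩
  · simp [he]
  set S := ⨆ y ∈ {y | rank μ g y < M}, rank μ g y with hS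
  have hSM : S ≤ M := iSup₂_le fun y hy => le_of_lt hy
  have hε2 : (ε : ℝ≥0∞) / 2 ≠ 0 := by simpa using hε.ne'
  obtain ⟨y0, hy0, hSy0⟩ : ∃ y0, rank μ g y0 < M ∧ S ≤ rank μ g y0 + ε / 2 := by
    by_contra! hcon
    have h1 : S + ε / 2 ≤ S := by
      conv_rhs => rw [hS]
      have hle : ∀ y, rank μ g y < M → rank μ g y + ε / 2 ≤ S := fun y hy => (hcon y hy).le
      have : S ≤ S - ε / 2 := iSup₂_le fun y hy =>
        ENNReal.le_sub_of_add_le_right (ENNReal.div_ne_top ENNReal.coe_ne_top (by simp)) (hle y hy)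
      have hge : (ε : ℝ≥0∞) / 2 ≤ S := le_trans le_add_self (hle y1 hy1)
      calc S + ε / 2 ≤ S - ε / 2 + ε / 2 := by gcongr
        _ = S := tsub_add_cancel_of_le hge
    exact (ENNReal.lt_add_right (ne_top_of_le_ne_top hM hSM) hε2).not_ge h1
  have hQ : μ ({y | rank μ g y < M} \ {y' | g y' < g y0}) ≤ 2 * (ε / 2) := by
    set Q := {y | rank μ g y < M} \ {y' | g y' < g y0} with hQdef
    have hQm : MeasurableSet Q := hD.diff (hP y0)
    -- `Q` is not yet known to have finite mass, so it is exhausted by pieces that do.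
    have hmono : Monotone fun n => Q ∩ spanningSets μ n := fun a b hab =>
      Set.inter_subset_inter_right _ (monotone_spanningSets μ hab)
    have hU : Q = ⋃ n, Q ∩ spanningSets μ n := by
      rw [← Set.inter_iUnion, iUnion_spanningSets, Set.inter_univ]
    rw [hU, hmono.measure_iUnion]
    refine iSup_le fun n => ?_
    have hQn : MeasurableSet (Q ∩ spanningSets μ n) := hQm.inter (measurableSet_spanningSets μ n)
    have : IsFiniteMeasure (μ.restrict (Q ∩ spanningSets μ n)) :=
      ⟨by
        rw [Measure.restrict_apply_univ]
        exact (measure_mono Set.inter_subset_right).trans_lt (measure_spanningSets_lt_top μ n)⟩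
    rw [← Measure.restrict_apply_univ (μ := μ)]
    refine measure_univ_le_of_measure_lt_le hg
      (fun y => Measure.absolutelyContinuous_of_le Measure.restrict_le_self (hties y)) ?_
    refine (ae_restrict_iff' hQn).2 (Filter.Eventually.of_forall fun y hy => ?_)
    rw [Measure.restrict_apply (hP y)]
    have hyD : rank μ g y < M := hy.1.1
    have hy0y : g y0 ≤ g y := not_lt.1 hy.1.2
    calc μ ({y' | g y' < g y} ∩ (Q ∩ spanningSets μ n))
        ≤ μ ({y' | g y' < g y} \ {y' | g y' < g y0}) :=
          measure_mono fun x hx => ⟨hx.1, hx.2.1.2⟩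
      _ = rank μ g y - rank μ g y0 :=
          measure_sdiff (fun x hx => lt_of_lt_of_le hx hy0y) (hP y0).nullMeasurableSet (hfin y0)
      _ ≤ ε / 2 := by
          rw [tsub_le_iff_left]
          exact (le_iSup₂ (f := fun y (_ : y ∈ {y | rank μ g y < M}) => rank μ g y) y hyD).trans hSy0
  calc μ {y | rank μ g y < M}
      ≤ μ ({y' | g y' < g y0} ∪ ({y | rank μ g y < M} \ {y' | g y' < g y0})) :=
        measure_mono fun x hx => (em _).imp id fun h => ⟨hx, h⟩
    _ ≤ rank μ g y0 + μ ({y | rank μ g y < M} \ {y' | g y' < g y0}) := measure_union_le _ _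
    _ ≤ M + 2 * (ε / 2) := by gcongr
    _ = M + ε := by rw [ENNReal.mul_div_cancel (by simp) (by simp)]

/-- Dual argument: `y0` nearly attains the infimum of the ranks at least `M`, and the predecessors
of `y0` with rank at least `M` have little mass by the reversed order. Infinite total mass settles
the case where no rank reaches `M`. -/
theorem le_measure_rank_lt (hg : MeasurableSet {p : α × α | g p.1 < g p.2})
    (hties : ∀ y, μ {y' | g y' = g y} = 0) (hfin : ∀ y, rank μ g y ≠ ∞) (htop : μ Set.univ = ∞)
    (M : ℝ≥0∞) : M ≤ μ {y | rank μ g y < M} := by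
  have hP : ∀ y, MeasurableSet {y' | g y' < g y} := fun y => hg.preimage measurable_prodMk_right
  have hD : MeasurableSet {y | rank μ g y < M} :=
    measurable_rank hg measurableSet_Iio
  rcases Set.eq_empty_or_nonempty {y | M ≤ rank μ g y} with he | ⟨y1, hy1⟩
  · have : {y | rank μ g y < M} = Set.univ := by
      rw [← Set.compl_empty_iff, ← he]; ext; simp
    rw [this, htop]; exact le_top
  refine ENNReal.le_of_forall_pos_le_add fun ε hε _ => ?_
  set c := ⨅ y ∈ {y | M ≤ rank μ g y}, rank μ g y with hc
  have hcM : M ≤ c := le_iInf₂ fun y hy => hy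
  have hctop : c ≠ ∞ := ne_top_of_le_ne_top (hfin y1) (iInf₂_le y1 hy1)
  have hε2 : (ε : ℝ≥0∞) / 2 ≠ 0 := by simpa using hε.ne'
  obtain ⟨y0, hy0, hcy0⟩ : ∃ y0, M ≤ rank μ g y0 ∧ rank μ g y0 ≤ c + ε / 2 := by
    by_contra! hcon
    exact (ENNReal.lt_add_right hctop hε2).not_ge (le_iInf₂ fun y hy => (hcon y hy).le)
  set Q := {y | M ≤ rank μ g y} ∩ {y' | g y' < g y0} with hQdef
  have hQm : MeasurableSet Q := (measurable_rank hg measurableSet_Ici).inter (hP y0)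
  have hQ : μ Q ≤ 2 * (ε / 2) := by
    have : IsFiniteMeasure (μ.restrict Q) :=
      ⟨by
        rw [Measure.restrict_apply_univ]
        exact (measure_mono Set.inter_subset_right).trans_lt (hfin y0).lt_top⟩
    rw [← Measure.restrict_apply_univ (μ := μ)]
    refine measure_univ_le_of_measure_lt_le (L := Lᵒᵈ) (g := fun y => OrderDual.toDual (g y))
      (show MeasurableSet {p : α × α | g p.2 < g p.1} from hg.preimage measurable_swap)
      (fun y => Measure.absolutelyContinuous_of_le Measure.restrict_le_self (hties y)) ?_
    refine (ae_restrict_iff' hQm).2 (Filter.Eventually.of_forall fun y hy => ?_)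
    have hlt : MeasurableSet {y' | OrderDual.toDual (g y') < OrderDual.toDual (g y)} :=
      hg.preimage measurable_prodMk_left
    rw [Measure.restrict_apply hlt]
    calc _ ≤ μ ({y' | g y' < g y0} \ {y' | g y' < g y}) :=
          measure_mono fun x hx => ⟨hx.2.2, not_lt.2 (OrderDual.toDual_lt_toDual.1 hx.1).le⟩
      _ = rank μ g y0 - rank μ g y :=
          measure_sdiff (fun x hx => lt_trans hx hy.2) (hP y).nullMeasurableSet (hfin y)
      _ ≤ ε / 2 := by
          rw [tsub_le_iff_left]
          refine hcy0.trans ?_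
          gcongr
          exact iInf₂_le y hy.1
  calc M ≤ rank μ g y0 := hy0
    _ ≤ μ ({y | rank μ g y < M} ∪ Q) :=
        measure_mono fun x hx => (lt_or_ge (rank μ g x) M).imp id fun h => ⟨h, hx⟩
    _ ≤ μ {y | rank μ g y < M} + μ Q := measure_union_le _ _
    _ ≤ μ {y | rank μ g y < M} + 2 * (ε / 2) := by gcongr
    _ = _ := by rw [ENNReal.mul_div_cancel (by simp) (by simp)]

/-- The rank function transports `μ` to Lebesgue measure on the half-line. -/
theorem measure_rank_lt (hg : MeasurableSet {p : α × α | g p.1 < g p.2})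
    (hties : ∀ y, μ {y' | g y' = g y} = 0) (hfin : ∀ y, rank μ g y ≠ ∞) (htop : μ Set.univ = ∞)
    {M : ℝ≥0∞} (hM : M ≠ ∞) : μ {y | rank μ g y < M} = M :=
  le_antisymm (measure_rank_lt_le hg hties hfin hM) (le_measure_rank_lt hg hties hfin htop M)

end Rank

/-! ### Splitting the coordinates -/

section Join

variable {n k : ℕ}

/-- The splitting of the coordinates of `ℝⁿ` underlying `join`. -/
def splitEquiv (hkn : k < n) : Fin k ⊕ Fin (n - k) ≃ Fin n :=
  finSumFinEquiv.trans (finCongr (by omega))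

theorem join_splitEquiv_inl (hkn : k < n) (y : EuclideanSpace ℝ (Fin k))
    (z : EuclideanSpace ℝ (Fin (n - k))) (i : Fin k) :
    join (n := n) y z (splitEquiv hkn (Sum.inl i)) = y i := by
  simp [join, splitEquiv]

theorem join_splitEquiv_inr (hkn : k < n) (y : EuclideanSpace ℝ (Fin k))
    (z : EuclideanSpace ℝ (Fin (n - k))) (i : Fin (n - k)) :
    join (n := n) y z (splitEquiv hkn (Sum.inr i)) = z i := by
  simp [join, splitEquiv]

theorem norm_join_sq (hkn : k < n) (y : EuclideanSpace ℝ (Fin k))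
    (z : EuclideanSpace ℝ (Fin (n - k))) : ‖join (n := n) y z‖ ^ 2 = ‖y‖ ^ 2 + ‖z‖ ^ 2 := by
  rw [EuclideanSpace.norm_sq_eq, EuclideanSpace.norm_sq_eq, EuclideanSpace.norm_sq_eq,
    ← (splitEquiv hkn).sum_comp, Fintype.sum_sum_type]
  simp only [join_splitEquiv_inl, join_splitEquiv_inr]

theorem measurePreserving_join (hkn : k < n) :
    MeasurePreserving (fun p : EuclideanSpace ℝ (Fin (n - k)) × EuclideanSpace ℝ (Fin k) =>
      join (n := n) p.2 p.1) := by
  have h1 : MeasurePreserving (fun p : EuclideanSpace ℝ (Fin k) × EuclideanSpace ℝ (Fin (n - k)) =>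
      ((WithLp.ofLp p.1, WithLp.ofLp p.2) : (Fin k → ℝ) × (Fin (n - k) → ℝ))) :=
    (PiLp.volume_preserving_ofLp (Fin k)).prod (PiLp.volume_preserving_ofLp (Fin (n - k)))
  have h2 := volume_measurePreserving_sumPiEquivProdPi_symm (fun _ : Fin k ⊕ Fin (n - k) => ℝ)
  have h3 := volume_measurePreserving_piCongrLeft (fun _ : Fin n => ℝ) (splitEquiv hkn)
  have h4 := PiLp.volume_preserving_toLp (Fin n)
  have h5 : MeasurePreserving (Prod.swap :
      EuclideanSpace ℝ (Fin (n - k)) × EuclideanSpace ℝ (Fin k) → _) := Measure.measurePreserving_swap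
  convert h4.comp (h3.comp (h2.comp (h1.comp h5))) using 1
  funext p
  ext i
  obtain ⟨j, rfl⟩ := (splitEquiv hkn).surjective i
  rcases j with j | j
  · rw [join_splitEquiv_inl]
    simp [MeasurableEquiv.piCongrLeft, MeasurableEquiv.sumPiEquivProdPi, Equiv.sumPiEquivProdPi]
  · rw [join_splitEquiv_inr]
    simp [MeasurableEquiv.piCongrLeft, MeasurableEquiv.sumPiEquivProdPi, Equiv.sumPiEquivProdPi]

theorem continuous_join : Continuous
    (fun p : EuclideanSpace ℝ (Fin (n - k)) × EuclideanSpace ℝ (Fin k) =>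
      join (n := n) p.2 p.1) := by
  refine (PiLp.continuous_toLp 2 _).comp (continuous_pi fun i => ?_)
  split_ifs <;> fun_prop

/-- The first `k` coordinates. -/
noncomputable def headPart (hkn : k < n) (w : EuclideanSpace ℝ (Fin n)) :
    EuclideanSpace ℝ (Fin k) :=
  WithLp.toLp 2 fun i => w (splitEquiv hkn (Sum.inl i))

/-- The last `n - k` coordinates. -/
noncomputable def tailPart (hkn : k < n) (w : EuclideanSpace ℝ (Fin n)) :
    EuclideanSpace ℝ (Fin (n - k)) :=
  WithLp.toLp 2 fun i => w (splitEquiv hkn (Sum.inr i))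

theorem headPart_join (hkn : k < n) (y : EuclideanSpace ℝ (Fin k))
    (z : EuclideanSpace ℝ (Fin (n - k))) : headPart hkn (join y z) = y := by
  ext i; exact join_splitEquiv_inl hkn y z i

theorem tailPart_join (hkn : k < n) (y : EuclideanSpace ℝ (Fin k))
    (z : EuclideanSpace ℝ (Fin (n - k))) : tailPart hkn (join y z) = z := by
  ext i; exact join_splitEquiv_inr hkn y z i

theorem measurable_headPart (hkn : k < n) : Measurable (headPart hkn) := by
  have : Continuous (headPart hkn) := by
    refine (PiLp.continuous_toLp 2 _).comp (continuous_pi fun i => ?_)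
    fun_prop
  exact this.measurable

theorem measurable_tailPart (hkn : k < n) : Measurable (tailPart hkn) := by
  have : Continuous (tailPart hkn) := by
    refine (PiLp.continuous_toLp 2 _).comp (continuous_pi fun i => ?_)
    fun_prop
  exact this.measurable

end Join

/-! ### Kernels built from a radius function -/

section Kernel

variable {n k : ℕ}

theorem volume_ball_eq (hk : 1 ≤ k) {R : ℝ} (hR : 0 ≤ R) :
    volume (Metric.ball (0 : EuclideanSpace ℝ (Fin k)) R) =
      ENNReal.ofReal (R ^ k * omega k) := by
  have : Nonempty (Fin k) := ⟨⟨0, hk⟩⟩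
  rw [Measure.addHaar_ball _ _ hR, ENNReal.ofReal_mul (by positivity), finrank_euclideanSpace_fin,
    omega, ofReal_measureReal measure_ball_lt_top.ne]

theorem omega_pos : 0 < omega k :=
  ENNReal.toReal_pos (Metric.measure_ball_pos _ _ one_pos).ne' measure_ball_lt_top.ne

theorem rpow_neg_lt_rpow_neg_half_iff {a r q : ℝ} (ha : 0 < a) (hr : 0 < r) (hq : 0 < q) :
    r ^ (-q) < a ^ (-(q / 2)) ↔ a < r ^ 2 := by
  have : r ^ (-q) = (r ^ 2) ^ (-(q / 2)) := by
    rw [← Real.rpow_natCast, ← Real.rpow_mul hr.le]; congr 1; push_cast; ring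
  rw [this]
  exact Real.rpow_lt_rpow_iff_of_neg (by positivity) ha (by linarith)

/-- The superlevel sets on a slice are the sets `τ² < r² - |z|²`, up to the zero set of `τ`, so only
the distribution of `τ(z, ·)` matters. -/
theorem isKernel_of_radius (hk : 1 ≤ k) (hkn : k < n) {s : ℝ} (hs : 0 < s)
    {τ : EuclideanSpace ℝ (Fin (n - k)) × EuclideanSpace ℝ (Fin k) → ℝ} (hτm : Measurable τ)
    (hτ0 : ∀ p, 0 ≤ τ p)
    (hτ : ∀ z (R : ℝ), 0 < R → volume {y | τ (z, y) < R} =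
      volume (Metric.ball (0 : EuclideanSpace ℝ (Fin k)) R)) :
    IsKernel k s (fun w : EuclideanSpace ℝ (Fin n) =>
      (τ (tailPart hkn w, headPart hkn w) ^ 2 + ‖tailPart hkn w‖ ^ 2) ^
        (-(((n : ℝ) + 2 * s) / 2))) := by
  have hq : 0 < (n : ℝ) + 2 * s := by positivity
  have hm := ((hτm.comp ((measurable_tailPart hkn).prodMk (measurable_headPart hkn))).pow_const 2
    |>.add ((measurable_tailPart hkn).norm.pow_const 2)).pow_const (-(((n : ℝ) + 2 * s) / 2))
  refine ⟨fun w => by positivity, hm.aemeasurable, fun z => ?_, fun z r hr => ?_⟩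
  · exact (hm.comp ((continuous_join (n := n)).measurable.comp
      measurable_prodMk_left)).aemeasurable
  simp only [headPart_join, tailPart_join]
  -- Where `τ` and `z` both vanish, the negative power takes the value `0` instead of `∞`, so the
  -- zero set of `τ` has to be discarded as null.
  have hnull : volume {y | τ (z, y) = 0} = 0 := by
    have hlim : Filter.Tendsto (fun R : ℝ => ENNReal.ofReal (R ^ k * omega k))
        (nhdsWithin 0 (Set.Ioi 0)) (nhds 0) := by
      have : Filter.Tendsto (fun R : ℝ => ENNReal.ofReal (R ^ k * omega k)) (nhds 0)
          (nhds (ENNReal.ofReal ((0 : ℝ) ^ k * omega k))) :=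
        (ENNReal.continuous_ofReal.comp (by fun_prop)).tendsto _
      rw [zero_pow (by omega), zero_mul, ENNReal.ofReal_zero] at this
      exact this.mono_left nhdsWithin_le_nhds
    refine le_antisymm (ge_of_tendsto hlim ?_) zero_le
    filter_upwards [self_mem_nhdsWithin] with R hR
    rw [← volume_ball_eq hk (le_of_lt hR), ← hτ z R hR]
    exact measure_mono fun y hy => by
      have : τ (z, y) = 0 := hy
      simpa [this] using hR
  split_ifs with hzr
  · have hpos : 0 < r ^ 2 - ‖z‖ ^ 2 := by nlinarith [norm_nonneg z]
    rw [← hτ z _ (Real.sqrt_pos.2 hpos)]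
    refine measure_congr ?_
    have hae : ∀ᵐ y, τ (z, y) ≠ 0 := by rw [ae_iff]; simpa using hnull
    filter_upwards [hae] with y hy
    have hyp : 0 < τ (z, y) := lt_of_le_of_ne (hτ0 _) hy.symm
    refine propext ?_
    change r ^ (-((n : ℝ) + 2 * s)) < _ ↔ τ (z, y) < √(r ^ 2 - ‖z‖ ^ 2)
    rw [rpow_neg_lt_rpow_neg_half_iff (by positivity) hr hq, Real.lt_sqrt hyp.le]
    constructor <;> intro h <;> linarith
  · have hz : 0 < ‖z‖ := lt_of_lt_of_le hr (not_lt.1 hzr)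
    convert measure_empty (μ := volume)
    refine Set.eq_empty_of_forall_notMem fun y hy => ?_
    rw [Set.mem_ofPred_eq, rpow_neg_lt_rpow_neg_half_iff (by positivity) hr hq] at hy
    nlinarith [sq_nonneg (τ (z, y)), not_lt.1 hzr]

end Kernel

/-! ### Layer cake for a product -/

section LayerCake

variable {α : Type*} [MeasurableSpace α] {μ : Measure α}

/-- Layer cake for `F` against the measure `κ dμ`, then for `κ` on each `{F > t}`. -/
theorem lintegral_ofReal_mul_eq_lintegral_meas [SFinite μ] {F κ : α → ℝ} (hF : Measurable F)
    (hF0 : ∀ y, 0 ≤ F y) (hκ : AEMeasurable κ μ) (hκ0 : ∀ y, 0 ≤ κ y) :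
    ∫⁻ y, ENNReal.ofReal (F y * κ y) ∂μ =
      ∫⁻ t in Set.Ioi (0 : ℝ), ∫⁻ l in Set.Ioi (0 : ℝ), μ ({y | l < κ y} ∩ {y | F y ≤ t}ᶜ) := by
  have h1 : ∫⁻ y, ENNReal.ofReal (F y * κ y) ∂μ =
      ∫⁻ y, ENNReal.ofReal (F y) ∂(μ.withDensity fun y => ENNReal.ofReal (κ y)) := by
    rw [lintegral_withDensity_eq_lintegral_mul₀ hκ.ennreal_ofReal
      hF.ennreal_ofReal.aemeasurable]
    refine lintegral_congr fun y => ?_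
    rw [Pi.mul_apply, mul_comm, ENNReal.ofReal_mul (hκ0 y)]
  rw [h1, lintegral_eq_lintegral_meas_lt _ (Filter.Eventually.of_forall hF0) hF.aemeasurable]
  refine lintegral_congr fun t => ?_
  have ht : MeasurableSet {y | t < F y} := hF measurableSet_Ioi
  have hc : {y | F y ≤ t}ᶜ = {y | t < F y} := by ext; simp
  rw [withDensity_apply _ ht, lintegral_eq_lintegral_meas_lt _ (Filter.Eventually.of_forall hκ0)
    hκ.restrict]
  refine lintegral_congr fun l => ?_
  rw [Measure.restrict_apply' ht, hc]

/-- The equality case of `le_measure_sdiff`: truncated subtraction gives the correct value `0` when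
`S ⊆ A`. -/
theorem measure_inter_compl_of_nested {S A : Set α} (hA : MeasurableSet A) (hAf : μ A ≠ ∞)
    (h : A ⊆ S ∨ S ⊆ A) : μ (S ∩ Aᶜ) = μ S - μ A := by
  rcases h with h | h
  · rw [← Set.sdiff_eq, measure_sdiff h hA.nullMeasurableSet hAf]
  · rw [tsub_eq_zero_of_le (measure_mono h), ← Set.sdiff_eq, Set.sdiff_eq_empty.2 h,
      measure_empty]

end LayerCake

/-! ### The profile `W` by scaling and polar coordinates -/

section Profile

variable {n k : ℕ}

/-- The integral over the complement of a ball of the slice of `|x|^{-n-2s}`. -/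
theorem setLIntegral_slice (hk : 1 ≤ k) (hkn : k < n) {s : ℝ} (hs : 0 < s)
    {z : EuclideanSpace ℝ (Fin (n - k))} (hz : z ≠ 0) {R : ℝ} (hR : 0 ≤ R) :
    ∫⁻ y in (Metric.closedBall (0 : EuclideanSpace ℝ (Fin k)) R)ᶜ,
        ENNReal.ofReal ((‖y‖ ^ 2 + ‖z‖ ^ 2) ^ (-(((n : ℝ) + 2 * s) / 2))) =
      ENNReal.ofReal (1 / ‖z‖ ^ ((n : ℝ) - k + 2 * s) * W n k s (R / ‖z‖)) := by
  have : Nonempty (Fin k) := ⟨⟨0, hk⟩⟩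
  have hz' : 0 < ‖z‖ := norm_pos_iff.2 hz
  set p := ((n : ℝ) + 2 * s) / 2 with hp
  set ρ := R / ‖z‖ with hρ
  set g : ℝ → ℝ := (Set.Ioi ρ).indicator fun r => (1 + r ^ 2) ^ (-p) with hg
  have hkn' : (k : ℝ) < n := by exact_mod_cast hkn
  have hGint : Integrable (fun y : EuclideanSpace ℝ (Fin k) => g ‖y‖) := by
    have h0 : Integrable (fun y : EuclideanSpace ℝ (Fin k) => (1 + ‖y‖ ^ 2) ^ (-p)) := by
      have := integrable_rpow_neg_one_add_norm_sq (E := EuclideanSpace ℝ (Fin k)) (μ := volume)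
        (r := n + 2 * s) (by rw [finrank_euclideanSpace_fin]; linarith)
      rw [hp]; simpa only [neg_div] using this
    exact h0.indicator (measurable_norm measurableSet_Ioi)
  have hscale : ∀ y : EuclideanSpace ℝ (Fin k),
      (Metric.closedBall (0 : EuclideanSpace ℝ (Fin k)) R)ᶜ.indicator
        (fun y => (‖y‖ ^ 2 + ‖z‖ ^ 2) ^ (-p)) y = ‖z‖ ^ (-(2 * p)) * g ‖‖z‖⁻¹ • y‖ := by
    intro y
    have hn : ‖‖z‖⁻¹ • y‖ = ‖y‖ / ‖z‖ := by
      rw [norm_smul, norm_inv, norm_norm]; field_simp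
    rw [hn, hg]
    by_cases hy : R < ‖y‖
    · rw [Set.indicator_of_mem (by simpa using hy),
        Set.indicator_of_mem (by simpa [hρ] using (div_lt_div_iff_of_pos_right hz').2 hy)]
      have h2 : ‖y‖ ^ 2 + ‖z‖ ^ 2 = ‖z‖ ^ 2 * (1 + (‖y‖ / ‖z‖) ^ 2) := by field_simp; ring
      have h3 : ‖z‖ ^ (-(2 * p)) = (‖z‖ ^ 2) ^ (-p) := by
        rw [← Real.rpow_natCast, ← Real.rpow_mul hz'.le]; congr 1; push_cast; ring
      rw [h2, Real.mul_rpow (by positivity) (by positivity), h3]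
    · rw [Set.indicator_of_notMem (by simpa using hy),
        Set.indicator_of_notMem (by
          simpa [hρ] using (div_le_div_iff_of_pos_right hz').2 (not_lt.1 hy)), mul_zero]
  have hint : Integrable (fun y : EuclideanSpace ℝ (Fin k) =>
      ‖z‖ ^ (-(2 * p)) * g ‖‖z‖⁻¹ • y‖) :=
    (hGint.comp_smul (inv_ne_zero hz'.ne')).const_mul _
  have hg0 : ∀ r, 0 ≤ g r := fun r => Set.indicator_nonneg (fun r _ => by positivity) r
  have hmeas : MeasurableSet (Metric.closedBall (0 : EuclideanSpace ℝ (Fin k)) R)ᶜ :=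
    Metric.isClosed_closedBall.measurableSet.compl
  have hWint : ∫ r in Set.Ioi (0 : ℝ), r ^ (k - 1) • g r =
      ∫ r in Set.Ioi ρ, r ^ (k - 1) / (1 + r ^ 2) ^ p := by
    have h1 : (fun r : ℝ => r ^ (k - 1) • g r) =
        (Set.Ioi ρ).indicator fun r => r ^ (k - 1) / (1 + r ^ 2) ^ p := by
      funext r
      by_cases hr : r ∈ Set.Ioi ρ
      · rw [hg, Set.indicator_of_mem hr, Set.indicator_of_mem hr, smul_eq_mul,
          Real.rpow_neg (by positivity), div_eq_mul_inv]
      · rw [hg, Set.indicator_of_notMem hr, Set.indicator_of_notMem hr, smul_zero]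
    rw [h1, setIntegral_indicator measurableSet_Ioi, Set.Ioi_inter_Ioi,
      sup_eq_right.2 (by positivity)]
  calc _ = ∫⁻ y, ENNReal.ofReal (‖z‖ ^ (-(2 * p)) * g ‖‖z‖⁻¹ • y‖) := by
        rw [← lintegral_indicator hmeas]
        refine lintegral_congr fun y => ?_
        rw [← hscale]
        by_cases hy : y ∈ (Metric.closedBall (0 : EuclideanSpace ℝ (Fin k)) R)ᶜ
        · rw [Set.indicator_of_mem hy, Set.indicator_of_mem hy]
        · rw [Set.indicator_of_notMem hy, Set.indicator_of_notMem hy, ENNReal.ofReal_zero]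
    _ = ENNReal.ofReal (∫ y, ‖z‖ ^ (-(2 * p)) * g ‖‖z‖⁻¹ • y‖) :=
        (ofReal_integral_eq_lintegral_ofReal hint (Filter.Eventually.of_forall fun y =>
          mul_nonneg (by positivity) (hg0 _))).symm
    _ = _ := by
      congr 1
      rw [integral_const_mul, Measure.integral_comp_smul volume (fun y => g ‖y‖),
        integral_fun_norm_addHaar volume g, finrank_euclideanSpace_fin, hWint, W, omega]
      -- The factor `‖z‖ ^ k` is the Jacobian of the dilation `y ↦ ‖z‖⁻¹ • y`.
      have h4 : ‖z‖ ^ (-(2 * p)) * ‖z‖ ^ k = 1 / ‖z‖ ^ ((n : ℝ) - k + 2 * s) := by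
        rw [one_div, ← Real.rpow_neg hz'.le, ← Real.rpow_natCast, ← Real.rpow_add hz']
        congr 1; rw [hp]; ring
      rw [← h4, inv_pow, inv_inv, abs_of_nonneg (by positivity)]
      simp only [smul_eq_mul, nsmul_eq_mul]
      ring

/-- The layer-cake form of `setLIntegral_slice`. -/
theorem lintegral_volume_slice_sub (hk : 1 ≤ k) (hkn : k < n) {s : ℝ} (hs : 0 < s)
    {z : EuclideanSpace ℝ (Fin (n - k))} (hz : z ≠ 0) {R : ℝ} (hR : 0 ≤ R) :
    ∫⁻ l in Set.Ioi (0 : ℝ), (volume {y : EuclideanSpace ℝ (Fin k) |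
        l < (‖y‖ ^ 2 + ‖z‖ ^ 2) ^ (-(((n : ℝ) + 2 * s) / 2))} -
          volume (Metric.ball (0 : EuclideanSpace ℝ (Fin k)) R)) =
      ENNReal.ofReal (1 / ‖z‖ ^ ((n : ℝ) - k + 2 * s) * W n k s (R / ‖z‖)) := by
  have : Nonempty (Fin k) := ⟨⟨0, hk⟩⟩
  have hz' : 0 < ‖z‖ := norm_pos_iff.2 hz
  have hcb : MeasurableSet (Metric.closedBall (0 : EuclideanSpace ℝ (Fin k)) R) :=
    Metric.isClosed_closedBall.measurableSet
  rw [← setLIntegral_slice hk hkn hs hz hR, lintegral_eq_lintegral_meas_lt _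
    (Filter.Eventually.of_forall fun y => by positivity)
    (Measurable.aemeasurable (by fun_prop))]
  refine lintegral_congr fun l => ?_
  rw [Measure.restrict_apply' hcb.compl, measure_inter_compl_of_nested hcb
    measure_closedBall_lt_top.ne, Measure.addHaar_closedBall_eq_addHaar_ball]
  -- The slice is radially decreasing, so its superlevel sets are nested with every centred ball.
  by_contra! hcon
  obtain ⟨⟨a, ha, ha'⟩, b, hb, hb'⟩ := hcon.imp Set.not_subset.1 Set.not_subset.1
  rw [Set.mem_ofPred_eq] at ha' hb
  refine ha' (lt_of_lt_of_le hb ?_)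
  have hab : ‖a‖ ≤ ‖b‖ := by
    have h1 : ‖a‖ ≤ R := by simpa using ha
    have h2 : R < ‖b‖ := by simpa using hb'
    linarith
  refine Real.rpow_le_rpow_of_nonpos (by positivity) (by gcongr) ?_
  have : 0 < (n : ℝ) + 2 * s := by positivity
  linarith

end Profile

/-! ### Integrability against the Riesz kernel -/

section Integrability

variable {n : ℕ}

/-- A quadratic remainder is `o(‖y‖)`, so the vector in the `C^{1,1}` bound must be the gradient. -/
theorem inner_gradient_eq {u : EuclideanSpace ℝ (Fin n) → ℝ} {x p : EuclideanSpace ℝ (Fin n)}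
    {ρ C : ℝ} (hρ : 0 < ρ)
    (h : ∀ y, ‖y‖ < ρ → |u (x + y) - u x - inner ℝ y p| ≤ C * ‖y‖ ^ 2) : ∇ u x = p := by
  refine HasGradientAt.gradient ?_
  rw [hasGradientAt_iff_isLittleO_nhds_zero]
  have h1 : (fun y => u (x + y) - u x - inner ℝ p y) =O[nhds 0]
      fun y : EuclideanSpace ℝ (Fin n) => ‖y‖ ^ 2 := by
    refine Asymptotics.IsBigO.of_bound C ?_
    filter_upwards [Metric.ball_mem_nhds 0 hρ] with y hy
    rw [real_inner_comm, Real.norm_eq_abs, norm_pow, norm_norm]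
    exact h y (by simpa using hy)
  refine h1.trans_isLittleO ?_
  exact Asymptotics.isLittleO_norm_right.1
    ((Asymptotics.isLittleO_pow_id (𝕜 := ℝ) (n := 2) one_lt_two).comp_tendsto
      (tendsto_norm_zero (E := EuclideanSpace ℝ (Fin n))))

theorem integrableOn_ball_norm_rpow (hn : 1 ≤ n) {a ρ : ℝ} (ha : -(n : ℝ) < a) :
    IntegrableOn (fun h : EuclideanSpace ℝ (Fin n) => ‖h‖ ^ a) (Metric.ball 0 ρ) := by
  have : Nonempty (Fin n) := ⟨⟨0, hn⟩⟩
  rw [integrableOn_fun_norm_addHaar volume (f := fun r : ℝ => r ^ a), finrank_euclideanSpace_fin]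
  rcases le_or_gt ρ 0 with hρ | hρ
  · rw [Set.Ioo_eq_empty (by linarith)]; exact integrableOn_empty
  have h1 : IntegrableOn (fun y : ℝ => y ^ ((n : ℝ) - 1 + a)) (Set.Ioo 0 ρ) :=
    (intervalIntegral.integrableOn_Ioo_rpow_iff hρ).2 (by linarith)
  refine h1.congr_fun (fun y hy => ?_) measurableSet_Ioo
  have hy0 : 0 < y := hy.1
  change y ^ ((n : ℝ) - 1 + a) = y ^ (n - 1) * y ^ a
  rw [Real.rpow_add hy0, ← Real.rpow_natCast, Nat.cast_sub hn, Nat.cast_one]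

theorem rpow_neg_le_of_le_mul {a b A q : ℝ} (ha : 0 < a) (hb : 0 < b) (hA : 0 < A) (hq : 0 ≤ q)
    (h : a ≤ A * b) : b ^ (-q) ≤ A ^ q * a ^ (-q) := by
  have h1 : a ^ q ≤ A ^ q * b ^ q := by
    rw [← Real.mul_rpow hA.le hb.le]; exact Real.rpow_le_rpow ha.le h hq
  rw [Real.rpow_neg hb.le, Real.rpow_neg ha.le, ← div_eq_mul_inv, inv_eq_one_div,
    div_le_div_iff₀ (by positivity) (by positivity)]
  linarith

/-- Near the origin the `C^{1,1}` bound leaves `‖h‖ ^ (2 - n - 2s)`, integrable since `s < 1`. Far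
away, `u(x + h)` is controlled by the weighted integrability of `u`, and the linear term `‖h‖ ^ (1 -
n - 2s)` is integrable since `s > 1/2`. -/
theorem integrable_tilde_mul_norm_rpow (hn : 1 ≤ n) {s : ℝ} (hs : s ∈ Set.Ioo (1 / 2 : ℝ) 1)
    {u : EuclideanSpace ℝ (Fin n) → ℝ} {x : EuclideanSpace ℝ (Fin n)} (hcont : Continuous u)
    (hC11 : IsC11At u x)
    (hint : Integrable (fun w : EuclideanSpace ℝ (Fin n) =>
      |u w| / (1 + ‖w‖) ^ ((n : ℝ) + 2 * s)) volume) :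
    Integrable (fun h : EuclideanSpace ℝ (Fin n) =>
      tilde u x h * ‖h‖ ^ (-((n : ℝ) + 2 * s))) := by
  obtain ⟨p, ρ, hρ, C, hC, hb⟩ := hC11
  have hgrad := inner_gradient_eq hρ hb
  obtain ⟨hs1, hs2⟩ := hs
  set q := (n : ℝ) + 2 * s with hq
  have hn' : (1 : ℝ) ≤ n := by exact_mod_cast hn
  -- Chosen so that `1 + ‖x‖ + ‖h‖ ≤ A * ‖h‖` for `‖h‖ ≥ ρ`; this makes the weights centred at `0`
  -- and at `-x` comparable to `‖h‖ ^ (-q)`.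
  set A : ℝ := 1 + (1 + ‖x‖) / ρ with hA
  have hA0 : 0 < A := by positivity
  have hi1 : Integrable ((Metric.ball (0 : EuclideanSpace ℝ (Fin n)) ρ).indicator
      fun h => C * ‖h‖ ^ (2 - q)) :=
    (integrable_indicator_iff measurableSet_ball).2
      ((integrableOn_ball_norm_rpow hn (by linarith)).const_mul C)
  have hi2 : Integrable fun h => |u (x + h)| / (1 + ‖x + h‖) ^ q := hint.comp_add_left x
  have hi3 : Integrable fun h : EuclideanSpace ℝ (Fin n) => (1 + ‖h‖) ^ (-q) :=
    integrable_one_add_norm (by rw [finrank_euclideanSpace_fin]; linarith)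
  have hi4 : Integrable fun h : EuclideanSpace ℝ (Fin n) => (1 + ‖h‖) ^ (-(q - 1)) :=
    integrable_one_add_norm (by rw [finrank_euclideanSpace_fin]; linarith)
  have hsum := hi1.add (((hi2.add (hi3.const_mul |u x|)).add (hi4.const_mul ‖p‖)).const_mul (A ^ q))
  refine hsum.mono' ?_ (Filter.Eventually.of_forall fun h => ?_)
  · refine Measurable.aestronglyMeasurable ?_
    unfold tilde
    have := hcont.measurable
    fun_prop
  simp only [Pi.add_apply]
  rw [norm_mul, Real.norm_eq_abs, Real.norm_of_nonneg (by positivity), tilde, hgrad]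
  by_cases hh : ‖h‖ < ρ
  · rw [Set.indicator_of_mem (by simpa using hh)]
    refine le_add_of_le_of_nonneg ?_ (by positivity)
    rcases eq_or_ne h 0 with rfl | h0
    · rw [norm_zero, Real.zero_rpow (x := -q) (by linarith), mul_zero]; positivity
    have hpos : 0 < ‖h‖ := norm_pos_iff.2 h0
    calc _ ≤ C * ‖h‖ ^ 2 * ‖h‖ ^ (-q) := by gcongr; exact hb h hh
      _ = C * ‖h‖ ^ (2 - q) := by
        rw [mul_assoc, ← Real.rpow_natCast, ← Real.rpow_add hpos]; norm_num [sub_eq_add_neg]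
  · rw [Set.indicator_of_notMem (by simpa using hh), zero_add]
    have hh' : ρ ≤ ‖h‖ := not_lt.1 hh
    have hpos : 0 < ‖h‖ := hρ.trans_le hh'
    have hkey : 1 + ‖x‖ + ‖h‖ ≤ A * ‖h‖ := by
      have : (1 + ‖x‖) ≤ (1 + ‖x‖) / ρ * ‖h‖ := by
        rw [div_mul_eq_mul_div, le_div_iff₀ hρ]; gcongr
      rw [hA]; linarith
    have e1 : ‖h‖ ^ (-q) ≤ A ^ q * (1 + ‖x + h‖) ^ (-q) :=
      rpow_neg_le_of_le_mul (by positivity) hpos hA0 (by linarith)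
        (by linarith [norm_add_le x h])
    have e2 : ‖h‖ ^ (-q) ≤ A ^ q * (1 + ‖h‖) ^ (-q) :=
      rpow_neg_le_of_le_mul (by positivity) hpos hA0 (by linarith)
        (by linarith [norm_nonneg x])
    have e3 : ‖h‖ * ‖h‖ ^ (-q) ≤ A ^ q * (1 + ‖h‖) ^ (-(q - 1)) := by
      calc ‖h‖ * ‖h‖ ^ (-q) ≤ (1 + ‖h‖) * (A ^ q * (1 + ‖h‖) ^ (-q)) := by
            gcongr; linarith
        _ = A ^ q * ((1 + ‖h‖) ^ (1 : ℝ) * (1 + ‖h‖) ^ (-q)) := by rw [Real.rpow_one]; ring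
        _ = _ := by rw [← Real.rpow_add (by positivity)]; ring_nf
    have htri : |u (x + h) - u x - inner ℝ h p| ≤ |u (x + h)| + |u x| + ‖h‖ * ‖p‖ := by
      have h1 := abs_sub (u (x + h) - u x) (inner ℝ h p)
      have h2 := abs_sub (u (x + h)) (u x)
      have h3 := abs_real_inner_le_norm h p
      linarith
    calc _ ≤ (|u (x + h)| + |u x| + ‖h‖ * ‖p‖) * ‖h‖ ^ (-q) := by gcongr
      _ = |u (x + h)| * ‖h‖ ^ (-q) + |u x| * ‖h‖ ^ (-q) + ‖p‖ * (‖h‖ * ‖h‖ ^ (-q)) := by ring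
      _ ≤ |u (x + h)| * (A ^ q * (1 + ‖x + h‖) ^ (-q)) + |u x| * (A ^ q * (1 + ‖h‖) ^ (-q)) +
          ‖p‖ * (A ^ q * (1 + ‖h‖) ^ (-(q - 1))) := by gcongr
      _ = _ := by
        rw [Real.rpow_neg (x := 1 + ‖x + h‖) (by positivity), div_eq_mul_inv]; ring

end Integrability

/-! ### The bathtub bound on slices and the optimal kernel -/

section Slices

variable {n k : ℕ}

/-- The slice at height `z` of `|x|^{-n-2s}`. -/
noncomputable def riesz (n : ℕ) {k : ℕ} (s : ℝ) (z : EuclideanSpace ℝ (Fin (n - k)))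
    (y : EuclideanSpace ℝ (Fin k)) : ℝ :=
  (‖y‖ ^ 2 + ‖z‖ ^ 2) ^ (-(((n : ℝ) + 2 * s) / 2))

/-- Every level `l > 0` has the form `r^{-n-2s}`, so the prescribed distribution covers all levels.
-/
theorem IsKernel.volume_slice_lt {s : ℝ} (hs : 0 < s)
    {K : EuclideanSpace ℝ (Fin n) → ℝ} (hK : IsKernel k s K)
    {z : EuclideanSpace ℝ (Fin (n - k))} (hz : z ≠ 0) {l : ℝ} (hl : 0 < l) :
    volume {y : EuclideanSpace ℝ (Fin k) | l < K (join y z)} =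
      volume {y : EuclideanSpace ℝ (Fin k) | l < riesz n s z y} := by
  have hz' : 0 < ‖z‖ := norm_pos_iff.2 hz
  have hq : 0 < (n : ℝ) + 2 * s := by positivity
  set r : ℝ := l ^ (-((n : ℝ) + 2 * s))⁻¹ with hr
  have hr0 : 0 < r := Real.rpow_pos_of_pos hl _
  have hrl : r ^ (-((n : ℝ) + 2 * s)) = l := Real.rpow_inv_rpow hl.le (by linarith)
  have h := hK.volume_slice z r hr0
  rw [hrl] at h
  rw [h]
  have hset : {y : EuclideanSpace ℝ (Fin k) | l < riesz n s z y} =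
      {y | ‖y‖ ^ 2 + ‖z‖ ^ 2 < r ^ 2} := by
    ext y
    rw [Set.mem_ofPred_eq, Set.mem_ofPred_eq, riesz, ← hrl]
    exact rpow_neg_lt_rpow_neg_half_iff (by positivity) hr0 hq
  rw [hset]
  split_ifs with hzr
  · congr 1
    ext y
    rw [mem_ball_zero_iff, Set.mem_ofPred_eq, Real.lt_sqrt (norm_nonneg y), lt_sub_iff_add_lt]
  · convert (measure_empty (μ := volume)).symm
    refine Set.eq_empty_of_forall_notMem fun y hy => ?_
    rw [Set.mem_ofPred_eq] at hy
    nlinarith [sq_nonneg ‖y‖, not_lt.1 hzr]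

theorem mu_nonneg (u : EuclideanSpace ℝ (Fin n) → ℝ) (x : EuclideanSpace ℝ (Fin n)) (t : ℝ)
    (z : EuclideanSpace ℝ (Fin (n - k))) : 0 ≤ mu k u x t z := by
  unfold mu omega; positivity

/-- The radius `μ^{1/k}` is that of the ball with the volume of the sublevel set, which reduces the
claim to `lintegral_volume_slice_sub`. -/
theorem lintegral_volume_sub_eq_integrand (hk : 1 ≤ k) (hkn : k < n) {s : ℝ} (hs : 0 < s)
    {u : EuclideanSpace ℝ (Fin n) → ℝ} {x : EuclideanSpace ℝ (Fin n)} {t : ℝ}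
    {z : EuclideanSpace ℝ (Fin (n - k))} (hz : z ≠ 0)
    (hfin : volume {y : EuclideanSpace ℝ (Fin k) | tilde u x (join y z) ≤ t} ≠ ∞) :
    ∫⁻ l in Set.Ioi (0 : ℝ), (volume {y : EuclideanSpace ℝ (Fin k) | l < riesz n s z y} -
        volume {y : EuclideanSpace ℝ (Fin k) | tilde u x (join y z) ≤ t}) =
      ENNReal.ofReal (integrand k s u x t z) := by
  have hmu : 0 ≤ mu k u x t z := mu_nonneg u x t z
  have hR : 0 ≤ mu k u x t z ^ (1 / (k : ℝ)) := by positivity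
  rw [integrand, ← lintegral_volume_slice_sub hk hkn hs hz hR, volume_ball_eq hk hR, one_div,
    Real.rpow_inv_natCast_pow hmu (by omega), mu, mul_right_comm, inv_mul_cancel₀ omega_pos.ne',
    one_mul, ofReal_measureReal hfin]
  rfl

theorem integrand_nonneg (s : ℝ) (u : EuclideanSpace ℝ (Fin n) → ℝ)
    (x : EuclideanSpace ℝ (Fin n)) (t : ℝ) (z : EuclideanSpace ℝ (Fin (n - k))) :
    0 ≤ integrand k s u x t z := by
  have hmu : 0 ≤ mu k u x t z := mu_nonneg u x t z
  have hW : 0 ≤ W n k s (mu k u x t z ^ (1 / (k : ℝ)) / ‖z‖) := by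
    refine mul_nonneg (mul_nonneg (Nat.cast_nonneg _) omega_pos.le)
      (setIntegral_nonneg measurableSet_Ioi fun r hr => ?_)
    have : 0 ≤ r := le_trans (by positivity) (le_of_lt hr)
    positivity
  unfold integrand
  positivity

theorem continuous_tilde_join {u : EuclideanSpace ℝ (Fin n) → ℝ} (hcont : Continuous u)
    (x : EuclideanSpace ℝ (Fin n)) :
    Continuous fun p : EuclideanSpace ℝ (Fin (n - k)) × EuclideanSpace ℝ (Fin k) =>
      tilde u x (join p.2 p.1) := by
  have h : Continuous (tilde u x) := by unfold tilde; fun_prop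
  exact h.comp continuous_join

theorem measurable_tilde_join_slice {u : EuclideanSpace ℝ (Fin n) → ℝ} (hcont : Continuous u)
    (x : EuclideanSpace ℝ (Fin n)) (z : EuclideanSpace ℝ (Fin (n - k))) :
    Measurable fun y : EuclideanSpace ℝ (Fin k) => tilde u x (join y z) := by
  have h : Continuous fun y : EuclideanSpace ℝ (Fin k) => tilde u x (join y z) :=
    (continuous_tilde_join hcont x).comp (f := fun y => (z, y)) (by fun_prop)
  exact h.measurable

variable {u : EuclideanSpace ℝ (Fin n) → ℝ} {x : EuclideanSpace ℝ (Fin n)}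

/-- Levelwise, removing `{ũ ≤ t}` from `{K > l}` costs at most the measure of `{ũ ≤ t}`. -/
theorem lintegral_integrand_le_slice (hk : 1 ≤ k) (hkn : k < n) {s : ℝ} (hs : 0 < s)
    (hcont : Continuous u) (hconv : ∀ w, 0 ≤ tilde u x w)
    (hfin : ∀ t : ℝ, 0 < t → ∀ z : EuclideanSpace ℝ (Fin (n - k)),
      volume {y : EuclideanSpace ℝ (Fin k) | tilde u x (join y z) ≤ t} < ⊤)
    {K : EuclideanSpace ℝ (Fin n) → ℝ} (hK : IsKernel k s K)
    {z : EuclideanSpace ℝ (Fin (n - k))} (hz : z ≠ 0) :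
    ∫⁻ t in Set.Ioi (0 : ℝ), ENNReal.ofReal (integrand k s u x t z) ≤
      ∫⁻ y, ENNReal.ofReal (tilde u x (join y z) * K (join y z)) := by
  have hf := measurable_tilde_join_slice (k := k) hcont x z
  rw [lintegral_ofReal_mul_eq_lintegral_meas hf (fun y => hconv _) (hK.measurable_slice z)
    (fun y => hK.nonneg _)]
  refine setLIntegral_mono' measurableSet_Ioi fun t ht => ?_
  rw [← lintegral_volume_sub_eq_integrand hk hkn hs hz (hfin t ht z).ne]
  refine setLIntegral_mono' measurableSet_Ioi fun l hl => ?_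
  rw [← hK.volume_slice_lt hs hz hl]
  exact le_measure_sdiff

/-- Opposite monotonicity of `K` and `ũ` nests their level sets, so no level loses anything. Nothing
is required of `K` where `ũ` has ties. -/
theorem lintegral_integrand_eq_slice (hk : 1 ≤ k) (hkn : k < n) {s : ℝ} (hs : 0 < s)
    (hcont : Continuous u) (hconv : ∀ w, 0 ≤ tilde u x w)
    (hfin : ∀ t : ℝ, 0 < t → ∀ z : EuclideanSpace ℝ (Fin (n - k)),
      volume {y : EuclideanSpace ℝ (Fin k) | tilde u x (join y z) ≤ t} < ⊤)
    {K : EuclideanSpace ℝ (Fin n) → ℝ} (hK : IsKernel k s K)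
    {z : EuclideanSpace ℝ (Fin (n - k))} (hz : z ≠ 0)
    (hmono : ∀ a b : EuclideanSpace ℝ (Fin k),
      tilde u x (join a z) < tilde u x (join b z) → K (join b z) ≤ K (join a z)) :
    ∫⁻ y, ENNReal.ofReal (tilde u x (join y z) * K (join y z)) =
      ∫⁻ t in Set.Ioi (0 : ℝ), ENNReal.ofReal (integrand k s u x t z) := by
  have hf := measurable_tilde_join_slice (k := k) hcont x z
  rw [lintegral_ofReal_mul_eq_lintegral_meas hf (fun y => hconv _) (hK.measurable_slice z)
    (fun y => hK.nonneg _)]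
  refine setLIntegral_congr_fun measurableSet_Ioi fun t ht => ?_
  rw [← lintegral_volume_sub_eq_integrand hk hkn hs hz (hfin t ht z).ne]
  refine setLIntegral_congr_fun measurableSet_Ioi fun l hl => ?_
  rw [← hK.volume_slice_lt hs hz hl,
    measure_inter_compl_of_nested (measurableSet_le hf measurable_const) (hfin t ht z).ne]
  by_contra! hcon
  obtain ⟨⟨a, ha, ha'⟩, b, hb, hb'⟩ := hcon.imp Set.not_subset.1 Set.not_subset.1
  rw [Set.mem_ofPred_eq] at ha ha' hb hb'
  exact ha' (hb.trans_le (hmono a b (by linarith)))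

theorem lintegral_eq_lintegral_join (hkn : k < n) (hcont : Continuous u) {s : ℝ}
    {K : EuclideanSpace ℝ (Fin n) → ℝ} (hK : IsKernel k s K) :
    ∫⁻ w, ENNReal.ofReal (tilde u x w * K w) =
      ∫⁻ z : EuclideanSpace ℝ (Fin (n - k)), ∫⁻ y : EuclideanSpace ℝ (Fin k),
        ENNReal.ofReal (tilde u x (join y z) * K (join y z)) := by
  have hj := measurePreserving_join hkn
  have ht : Continuous (tilde u x) := by unfold tilde; fun_prop
  have hm : AEMeasurable (fun w => ENNReal.ofReal (tilde u x w * K w)) :=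
    (ht.measurable.aemeasurable.mul hK.measurable).ennreal_ofReal
  have h1 := lintegral_map' (μ := volume)
    (f := fun w => ENNReal.ofReal (tilde u x w * K w)) (by rw [hj.map_eq]; exact hm)
    hj.measurable.aemeasurable
  rw [hj.map_eq] at h1
  rw [h1]
  exact lintegral_prod _ (hm.comp_quasiMeasurePreserving hj.quasiMeasurePreserving)

/-- The model kernel, with radius function `‖y‖`; it serves as the competitor that proves
finiteness. -/
theorem isKernel_norm_rpow (hk : 1 ≤ k) (hkn : k < n) {s : ℝ} (hs : 0 < s) :
    IsKernel k s fun w : EuclideanSpace ℝ (Fin n) => ‖w‖ ^ (-((n : ℝ) + 2 * s)) := by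
  have h := isKernel_of_radius hk hkn hs
    (τ := fun p : EuclideanSpace ℝ (Fin (n - k)) × EuclideanSpace ℝ (Fin k) => ‖p.2‖)
    (by fun_prop) (fun p => norm_nonneg _)
    (fun z R _ => by congr 1; ext y; simp)
  convert h using 2 with w
  have hw : join (headPart hkn w) (tailPart hkn w) = w := by
    ext i
    obtain ⟨j | j, rfl⟩ := (splitEquiv hkn).surjective i
    · rw [join_splitEquiv_inl]; rfl
    · rw [join_splitEquiv_inr]; rfl
  rw [← norm_join_sq hkn, hw, ← Real.rpow_natCast, ← Real.rpow_mul (norm_nonneg w)]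
  congr 1; push_cast; ring

/-- The order by the value of `ũ` on the slice, ties being broken by the norm. -/
noncomputable def sliceKey (u : EuclideanSpace ℝ (Fin n) → ℝ) (x : EuclideanSpace ℝ (Fin n))
    (z : EuclideanSpace ℝ (Fin (n - k))) (y : EuclideanSpace ℝ (Fin k)) : ℝ ×ₗ ℝ :=
  toLex (tilde u x (join y z), ‖y‖)

/-- The radius of the ball with the volume of the set of predecessors of `y` on its slice. -/
noncomputable def sliceRadius (u : EuclideanSpace ℝ (Fin n) → ℝ) (x : EuclideanSpace ℝ (Fin n))
    (p : EuclideanSpace ℝ (Fin (n - k)) × EuclideanSpace ℝ (Fin k)) : ℝ :=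
  ((rank volume (sliceKey u x p.1) p.2).toReal / omega k) ^ (1 / (k : ℝ))

/-- Measurability jointly in `z` and both slice points, because the optimal kernel must be
measurable on the whole space and not only on slices. -/
theorem measurableSet_sliceKey_lt (hcont : Continuous u) (x : EuclideanSpace ℝ (Fin n)) :
    MeasurableSet {q : (EuclideanSpace ℝ (Fin (n - k)) × EuclideanSpace ℝ (Fin k)) ×
      EuclideanSpace ℝ (Fin k) | sliceKey u x q.1.1 q.2 < sliceKey u x q.1.1 q.1.2} := by
  have h := (continuous_tilde_join (k := k) hcont x).measurable
  have p1 : Measurable fun q : (EuclideanSpace ℝ (Fin (n - k)) × EuclideanSpace ℝ (Fin k)) ×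
      EuclideanSpace ℝ (Fin k) => (q.1.1, q.2) := by fun_prop
  have h1 := h.comp p1
  have p2 : Measurable fun q : (EuclideanSpace ℝ (Fin (n - k)) × EuclideanSpace ℝ (Fin k)) ×
      EuclideanSpace ℝ (Fin k) => q.1 := measurable_fst
  have h2 := h.comp p2
  have h3 : MeasurableSet {q : (EuclideanSpace ℝ (Fin (n - k)) × EuclideanSpace ℝ (Fin k)) ×
      EuclideanSpace ℝ (Fin k) | ‖q.2‖ < ‖q.1.2‖} :=
    measurableSet_lt (by fun_prop) (by fun_prop)
  convert (measurableSet_lt h1 h2).union ((measurableSet_eq_fun h1 h2).inter h3) using 1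
  ext q
  exact Prod.Lex.toLex_lt_toLex

theorem measurable_sliceRadius (hcont : Continuous u) (x : EuclideanSpace ℝ (Fin n)) :
    Measurable (sliceRadius (k := k) u x) :=
  ((measurable_measure_prodMk_left (ν := volume)
    (measurableSet_sliceKey_lt hcont x)).ennreal_toReal.div_const _).pow_const _

theorem rank_sliceKey_ne_top
    (hfin : ∀ t : ℝ, 0 < t → ∀ z : EuclideanSpace ℝ (Fin (n - k)),
      volume {y : EuclideanSpace ℝ (Fin k) | tilde u x (join y z) ≤ t} < ⊤)
    (z : EuclideanSpace ℝ (Fin (n - k))) (y : EuclideanSpace ℝ (Fin k)) :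
    rank volume (sliceKey u x z) y ≠ ∞ := by
  -- The maximum with `1` keeps the level positive, since sublevel sets are assumed finite only for
  -- `t > 0` and `ũ` may vanish.
  have hsub : {y' | sliceKey u x z y' < sliceKey u x z y} ⊆
      {y' | tilde u x (join y' z) ≤ max (tilde u x (join y z)) 1} := by
    intro y' hy'
    have h' : sliceKey u x z y' < sliceKey u x z y := hy'
    have h : tilde u x (join y' z) ≤ tilde u x (join y z) :=
      (Prod.Lex.toLex_lt_toLex.1 h').elim le_of_lt fun h => h.1.le
    exact h.trans (le_max_left _ _)
  exact ((measure_mono hsub).trans_lt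
    (hfin (max (tilde u x (join y z)) 1) (by positivity) z)).ne

/-- Radius below `R` means rank below `ω_k R^k`, and `measure_rank_lt` gives that set exactly this
measure. -/
theorem volume_sliceRadius_lt (hk : 1 ≤ k) (hcont : Continuous u)
    (hfin : ∀ t : ℝ, 0 < t → ∀ z : EuclideanSpace ℝ (Fin (n - k)),
      volume {y : EuclideanSpace ℝ (Fin k) | tilde u x (join y z) ≤ t} < ⊤)
    (z : EuclideanSpace ℝ (Fin (n - k))) {R : ℝ} (hR : 0 < R) :
    volume {y | sliceRadius u x (z, y) < R} =
      volume (Metric.ball (0 : EuclideanSpace ℝ (Fin k)) R) := by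
  have : Nonempty (Fin k) := ⟨⟨0, hk⟩⟩
  have hk' : 0 < (k : ℝ) := by exact_mod_cast hk
  have hset : {y | sliceRadius u x (z, y) < R} =
      {y | rank volume (sliceKey u x z) y < ENNReal.ofReal (R ^ k * omega k)} := by
    ext y
    rw [Set.mem_ofPred_eq, Set.mem_ofPred_eq, sliceRadius, one_div,
      Real.rpow_inv_lt_iff_of_pos (div_nonneg ENNReal.toReal_nonneg omega_pos.le) hR.le hk',
      Real.rpow_natCast, div_lt_iff₀ omega_pos,
      ENNReal.lt_ofReal_iff_toReal_lt (rank_sliceKey_ne_top hfin z y)]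
  rw [hset, volume_ball_eq hk hR.le]
  refine measure_rank_lt ?_ (fun y => ?_) (rank_sliceKey_ne_top hfin z)
    (measure_univ_of_isAddLeftInvariant _) ENNReal.ofReal_ne_top
  · exact (measurableSet_sliceKey_lt hcont x).preimage
      (f := fun p : EuclideanSpace ℝ (Fin k) × EuclideanSpace ℝ (Fin k) => ((z, p.2), p.1))
      (by fun_prop)
  -- Points with equal keys have equal norms, hence lie on one sphere.
  · refine measure_mono_null (fun y' hy' => ?_) (Measure.addHaar_sphere volume 0 ‖y‖)
    have h : sliceKey u x z y' = sliceKey u x z y := hy'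
    rw [sliceKey, sliceKey, toLex_inj, Prod.mk.injEq] at h
    simpa using h.2

/-- This is the monotone rearrangement: larger `ũ` means larger rank, hence larger radius and
smaller kernel. -/
theorem exists_isKernel_slice_antitone (hk : 1 ≤ k) (hkn : k < n) {s : ℝ} (hs : 0 < s)
    (hcont : Continuous u)
    (hfin : ∀ t : ℝ, 0 < t → ∀ z : EuclideanSpace ℝ (Fin (n - k)),
      volume {y : EuclideanSpace ℝ (Fin k) | tilde u x (join y z) ≤ t} < ⊤) :
    ∃ K : EuclideanSpace ℝ (Fin n) → ℝ, IsKernel k s K ∧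
      ∀ z : EuclideanSpace ℝ (Fin (n - k)), z ≠ 0 → ∀ a b : EuclideanSpace ℝ (Fin k),
        tilde u x (join a z) < tilde u x (join b z) → K (join b z) ≤ K (join a z) := by
  have hτ0 : ∀ p, 0 ≤ sliceRadius (k := k) u x p := fun p =>
    Real.rpow_nonneg (div_nonneg ENNReal.toReal_nonneg omega_pos.le) _
  refine ⟨_, isKernel_of_radius hk hkn hs (measurable_sliceRadius hcont x) hτ0
    fun z R hR => volume_sliceRadius_lt hk hcont hfin z hR, fun z hz a b hab => ?_⟩
  simp only [headPart_join, tailPart_join]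
  have hz' : 0 < ‖z‖ := norm_pos_iff.2 hz
  have hle : sliceRadius u x (z, a) ≤ sliceRadius u x (z, b) := by
    refine Real.rpow_le_rpow (div_nonneg ENNReal.toReal_nonneg omega_pos.le) ?_ (by positivity)
    refine div_le_div_of_nonneg_right (ENNReal.toReal_mono (rank_sliceKey_ne_top hfin z b)
      (rank_mono (L := ℝ ×ₗ ℝ) ?_)) omega_pos.le
    exact (Prod.Lex.toLex_lt_toLex.2 (Or.inl hab)).le
  have := hτ0 (z, a)
  refine Real.rpow_le_rpow_of_nonpos (by positivity) (by gcongr) ?_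
  have : 0 < (n : ℝ) + 2 * s := by positivity
  linarith

theorem extIntegral_of_nonneg {f : EuclideanSpace ℝ (Fin n) → ℝ} (hf : ∀ w, 0 ≤ f w) :
    extIntegral f = ((∫⁻ w, ENNReal.ofReal (f w) : ℝ≥0∞) : EReal) := by
  have h : ∫⁻ w, ENNReal.ofReal (-f w) = 0 := by
    rw [← lintegral_zero (μ := (volume : Measure (EuclideanSpace ℝ (Fin n))))]
    exact lintegral_congr fun w => ENNReal.ofReal_of_nonpos (by linarith [hf w])
  rw [extIntegral, h]; simp

/-- For `t > 0` and `z ≠ 0` the integrand is an integral over `l` of truncated differences of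
measures of sections, which are measurable in the parameters. -/
theorem aemeasurable_integrand (hk : 1 ≤ k) (hkn : k < n) {s : ℝ} (hs : 0 < s)
    (hcont : Continuous u)
    (hfin : ∀ t : ℝ, 0 < t → ∀ z : EuclideanSpace ℝ (Fin (n - k)),
      volume {y : EuclideanSpace ℝ (Fin k) | tilde u x (join y z) ≤ t} < ⊤) :
    AEMeasurable (fun p : ℝ × EuclideanSpace ℝ (Fin (n - k)) => integrand k s u x p.1 p.2)
      ((volume.restrict (Set.Ioi (0 : ℝ))).prod volume) := by
  have : Nonempty (Fin (n - k)) := ⟨⟨0, by omega⟩⟩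
  have hm1 : Measurable fun q : (ℝ × EuclideanSpace ℝ (Fin (n - k))) × ℝ =>
      volume {y : EuclideanSpace ℝ (Fin k) | q.2 < riesz n s q.1.2 y} :=
    measurable_measure_prodMk_left (ν := volume)
      (s := {r : ((ℝ × EuclideanSpace ℝ (Fin (n - k))) × ℝ) × EuclideanSpace ℝ (Fin k) |
        r.1.2 < riesz n s r.1.1.2 r.2})
      (measurableSet_lt (by fun_prop) (by unfold riesz; fun_prop))
  have hm2 : Measurable fun q : (ℝ × EuclideanSpace ℝ (Fin (n - k))) × ℝ =>
      volume {y : EuclideanSpace ℝ (Fin k) | tilde u x (join y q.1.2) ≤ q.1.1} :=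
    measurable_measure_prodMk_left (ν := volume)
      (s := {r : ((ℝ × EuclideanSpace ℝ (Fin (n - k))) × ℝ) × EuclideanSpace ℝ (Fin k) |
        tilde u x (join r.2 r.1.1.2) ≤ r.1.1.1})
      (measurableSet_le ((continuous_tilde_join hcont x).measurable.comp
        (f := fun r : ((ℝ × EuclideanSpace ℝ (Fin (n - k))) × ℝ) × EuclideanSpace ℝ (Fin k) =>
          (r.1.1.2, r.2)) (by fun_prop)) (by fun_prop))
  have hm := ((hm1.sub hm2).lintegral_prod_right'
    (ν := volume.restrict (Set.Ioi (0 : ℝ)))).ennreal_toReal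
  refine ⟨_, hm, ?_⟩
  have ht : ∀ᵐ p ∂((volume.restrict (Set.Ioi (0 : ℝ))).prod
      (volume : Measure (EuclideanSpace ℝ (Fin (n - k))))), p.1 ∈ Set.Ioi (0 : ℝ) :=
    Measure.quasiMeasurePreserving_fst.ae (ae_restrict_mem measurableSet_Ioi)
  have hz : ∀ᵐ p ∂((volume.restrict (Set.Ioi (0 : ℝ))).prod
      (volume : Measure (EuclideanSpace ℝ (Fin (n - k))))), p.2 ≠ 0 :=
    Measure.quasiMeasurePreserving_snd.ae (compl_mem_ae_iff.2 (measure_singleton 0))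
  filter_upwards [ht, hz] with p hp1 hp2
  simp only [Pi.sub_apply]
  rw [lintegral_volume_sub_eq_integrand hk hkn hs hp2 (hfin p.1 hp1 p.2).ne,
    ENNReal.toReal_ofReal (integrand_nonneg s u x p.1 p.2)]

end Slices

end NonlocalMA

/-! ### The formula -/

theorem proposition5p4 (n k : ℕ) (hk : 1 ≤ k) (hkn : k < n) (s : ℝ)
    (hs : s ∈ Set.Ioo (1 / 2 : ℝ) 1)
    (u : EuclideanSpace ℝ (Fin n) → ℝ) (x : EuclideanSpace ℝ (Fin n))
    (hcont : Continuous u)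
    (hC11 : NonlocalMA.IsC11At u x)
    (hint : Integrable (fun w : EuclideanSpace ℝ (Fin n) =>
      |u w| / (1 + ‖w‖) ^ ((n : ℝ) + 2 * s)) volume)
    (hconv : ∀ w : EuclideanSpace ℝ (Fin n), 0 ≤ NonlocalMA.tilde u x w)
    (hfin : ∀ t : ℝ, 0 < t → ∀ z : EuclideanSpace ℝ (Fin (n - k)),
      volume {y : EuclideanSpace ℝ (Fin k) |
        NonlocalMA.tilde u x (NonlocalMA.join y z) ≤ t} < ⊤) :
    Integrable
        (fun p : ℝ × EuclideanSpace ℝ (Fin (n - k)) => NonlocalMA.integrand k s u x p.1 p.2)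
        ((volume.restrict (Set.Ioi (0 : ℝ))).prod volume) ∧
      NonlocalMA.fracOp k s u x =
        ((NonlocalMA.fracConst n s *
          ∫ t in Set.Ioi (0 : ℝ), ∫ z : EuclideanSpace ℝ (Fin (n - k)),
            NonlocalMA.integrand k s u x t z : ℝ) : EReal) := by
  have hs0 : 0 < s := lt_trans (by norm_num) hs.1
  have : Nonempty (Fin (n - k)) := ⟨⟨0, by omega⟩⟩
  have hz0 : ∀ᵐ z : EuclideanSpace ℝ (Fin (n - k)), z ≠ 0 :=
    compl_mem_ae_iff.2 (measure_singleton 0)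
  have hmeas := NonlocalMA.aemeasurable_integrand (x := x) hk hkn hs0 hcont hfin
  set J : ℝ≥0∞ := ∫⁻ p, ENNReal.ofReal (NonlocalMA.integrand k s u x p.1 p.2)
    ∂((volume.restrict (Set.Ioi (0 : ℝ))).prod
      (volume : Measure (EuclideanSpace ℝ (Fin (n - k))))) with hJ
  have hJz : J = ∫⁻ z, ∫⁻ t in Set.Ioi (0 : ℝ),
      ENNReal.ofReal (NonlocalMA.integrand k s u x t z) :=
    lintegral_prod_symm _ hmeas.ennreal_ofReal
  have hlower : ∀ K, NonlocalMA.IsKernel k s K →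
      J ≤ ∫⁻ w, ENNReal.ofReal (NonlocalMA.tilde u x w * K w) := fun K hK => by
    rw [hJz, NonlocalMA.lintegral_eq_lintegral_join hkn hcont hK]
    refine lintegral_mono_ae ?_
    filter_upwards [hz0] with z hz
    exact NonlocalMA.lintegral_integrand_le_slice hk hkn hs0 hcont hconv hfin hK hz
  -- The lower bound, tested with the model kernel, bounds `J` by a convergent integral.
  have hJtop : J < ∞ :=
    (hlower _ (NonlocalMA.isKernel_norm_rpow hk hkn hs0)).trans_lt
      (NonlocalMA.integrable_tilde_mul_norm_rpow (by omega) hs hcont hC11 hint).lintegral_lt_top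
  have hnonneg : ∀ p : ℝ × EuclideanSpace ℝ (Fin (n - k)),
      0 ≤ NonlocalMA.integrand k s u x p.1 p.2 := fun p =>
    NonlocalMA.integrand_nonneg s u x p.1 p.2
  have hInt : Integrable
      (fun p : ℝ × EuclideanSpace ℝ (Fin (n - k)) => NonlocalMA.integrand k s u x p.1 p.2)
      ((volume.restrict (Set.Ioi (0 : ℝ))).prod volume) :=
    ⟨hmeas.aestronglyMeasurable, by
      rw [hasFiniteIntegral_iff_ofReal (Filter.Eventually.of_forall hnonneg)]; exact hJtop⟩
  refine ⟨hInt, ?_⟩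
  have hval : ENNReal.ofReal (∫ t in Set.Ioi (0 : ℝ), ∫ z : EuclideanSpace ℝ (Fin (n - k)),
      NonlocalMA.integrand k s u x t z) = J := by
    rw [← integral_prod _ hInt]
    exact ofReal_integral_eq_lintegral_ofReal hInt (Filter.Eventually.of_forall hnonneg)
  have hval0 : 0 ≤ ∫ t in Set.Ioi (0 : ℝ), ∫ z : EuclideanSpace ℝ (Fin (n - k)),
      NonlocalMA.integrand k s u x t z :=
    integral_nonneg fun t => integral_nonneg fun z => hnonneg (t, z)
  have hinf : ⨅ K : {K : EuclideanSpace ℝ (Fin n) → ℝ // NonlocalMA.IsKernel k s K},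
      NonlocalMA.extIntegral (fun w => NonlocalMA.tilde u x w * K.1 w) = (J : EReal) := by
    refine le_antisymm ?_ (le_iInf fun K => ?_)
    · obtain ⟨K, hK, hmono⟩ :=
        NonlocalMA.exists_isKernel_slice_antitone (x := x) hk hkn hs0 hcont hfin
      refine (iInf_le _ ⟨K, hK⟩).trans (le_of_eq ?_)
      rw [NonlocalMA.extIntegral_of_nonneg fun w => mul_nonneg (hconv w) (hK.nonneg w),
        NonlocalMA.lintegral_eq_lintegral_join hkn hcont hK, hJz]
      congr 1
      refine lintegral_congr_ae ?_
      filter_upwards [hz0] with z hz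
      exact NonlocalMA.lintegral_integrand_eq_slice hk hkn hs0 hcont hconv hfin hK hz
        (hmono z hz)
    · rw [NonlocalMA.extIntegral_of_nonneg fun w => mul_nonneg (hconv w) (K.2.nonneg w)]
      exact EReal.coe_ennreal_le_coe_ennreal_iff.2 (hlower K.1 K.2)
  rw [NonlocalMA.fracOp, hinf, ← hval, EReal.coe_ennreal_ofReal, max_eq_left hval0,
    EReal.coe_mul]
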